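/- Let $\mathcal A$ be a finite Boolean group (an elementary abelian $2$-group) of order $N$ with identity $I$ and a symmetric, non-degenerate bilinear form $\beta:\mathcal A\times\mathcal A\to\mathbb F_2$. Let $\mathscr M\subseteq\mathcal A$ be a subgroup (for instance the centre $\mathscr G\cap\mathscr G^\perp$ of a gauge group $\mathscr G$, or $\mathscr M=\mathcal A$). The syndrome of $a\in\mathcal A$ is $\sigma(a)=(\beta(a,m))_{m\in\mathscr M}$. Let $\mathcal K_{\mathscr M}\subseteq\mathcal A$ be a set of elements with non-zero, pairwise distinct syndromes, and let $K=|\mathcal K_{\mathscr M}|$. Let $\Phi=\big(N^{-1/2}(-1)^{\beta(a,b)}\big)_{a,b\in\mathcal A}$ be the Walsh–Hadamard matrix of $\mathcal A$. For a sequence $Q=(Q_1,\dots,Q_q)$ in $\mathscr M$, let $H\in\mathbb C^{q\times N}$ be the matrix whose rows are the rows $Q_1,\dots,Q_q$ of $\Phi$, rescaled by $\sqrt{N/q}$, and let $A_{\mathscr M,\mathrm{res}}\in\{0,1\}^{q\times K}$ be the real matrix with entries $\beta(Q_j,b)$, $b\in\mathcal K_{\mathscr M}$. A matrix $H$ has the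 restricted isometry property (RIP) of order $k$ with constant $\varepsilon$ on a set $S$ of columns if $(1-\varepsilon)\|x\|_2^2\le\|Hx\|_2^2\le(1+\varepsilon)\|x\|_2^2$ for every complex $k$-sparse vector $x$ supported on $S$. For $\delta_K>0$ and $0<\delta<1$ put $$ s(K,\delta_K,\delta)=\delta_K^{-2}\,K\,\max\!\big(\log^2(K/\delta_K)\,\log^2(1/\delta_K)\,\log K,\ \log(1/\delta)\big). $$ 1. There are absolute constants $C,\delta_0>0$ such that for all $\mathcal A,\beta,\mathscr M,\mathcal K_{\mathscr M}$ as above with $K\ge 1$, all $0<\delta_K\le\delta_0$, all $0<\delta<1$ (with $\delta\le\frac12$ if $K=1$) and all integers $q\ge C\,s(K,\delta_K,\delta)$: if $Q_1,\dots,Q_q$ are drawn independently and uniformly, with replacement, from $\mathscr M$, then with probability at least $1-\delta$ the matrix $H$ has the RIP of order $K+1$ with constant $\delta_K$ on $\mathcal K_{\mathscr M}\cup\{I\}$, and $A_{\mathscr M,\mathrm{res}}$ has full column rank $K$, equivalently $A_{\mathscr M,\mathrm{res}}^{T}A_{\mathscr M,\mathrm{res}}$ has full rank. 2. For every sequence $Q$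 in $\mathscr M$: if $H$ has the RIP of order $K+1$ with a constant $\delta_K<1$ on $\mathcal K_{\mathscr M}\cup\{I\}$, then $A_{\mathscr M,\mathrm{res}}$ has full column rank. 3. More generally, for every $B>0$ there are $C,\delta_0>0$ such that for every $N$, every unitary $\Phi\in\mathbb C^{N\times N}$ with all entries of modulus at most $B/\sqrt N$, every set $S$ of $K+1\ge 2$ columns, and all $\delta_K,\delta,q$ as in 1 (with these $C$, $\delta_0$): the matrix of $q$ independent uniformly chosen rows of $\Phi$, rescaled by $\sqrt{N/q}$, has the RIP of order $K+1$ with constant $\delta_K$ on $S$ with probability at least $1-\delta$. -/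

import Mathlib

/-- The syndrome of `a` with respect to the subgroup `M` of a Boolean group: the vector
`σ(a) = (β(a, m))_{m ∈ M}` over `𝔽₂`. -/
def syndrome {A : Type*} [AddCommGroup A] [Module (ZMod 2) A]
    (β : LinearMap.BilinForm (ZMod 2) A) (M : Submodule (ZMod 2) A) (a : A) : M → ZMod 2 :=
  fun m => β a m

/-- The elements of `S` have non-zero and pairwise distinct syndromes with respect to `M`. -/
def HasDistinctNonzeroSyndromes {A : Type*} [AddCommGroup A] [Module (ZMod 2) A]
    (β : LinearMap.BilinForm (ZMod 2) A) (M : Submodule (ZMod 2) A) (S : Finset A) : Prop :=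
  (∀ a ∈ S, syndrome β M a ≠ 0) ∧ Set.InjOn (syndrome β M) (S : Set A)

/-- The (unitary) Walsh–Hadamard matrix of the Boolean group `A` of order `N` with its bilinear
form `β`: the entry at `(a, b)` is `(-1)^{β(a, b)} / √N`. -/
noncomputable def walshHadamard {A : Type*} [AddCommGroup A] [Module (ZMod 2) A] [Fintype A]
    (β : LinearMap.BilinForm (ZMod 2) A) : Matrix A A ℂ :=
  Matrix.of fun a b => (-1 : ℂ) ^ (β a b).val / ((Real.sqrt (Fintype.card A) : ℝ) : ℂ)

/-- The matrix whose `q` rows are the rows `Q 0, …, Q (q - 1)` of the `N × N` matrix `Φ`,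
rescaled by `√(N / q)`. -/
noncomputable def rowSubsample {ι : Type*} [Fintype ι] (Φ : Matrix ι ι ℂ) {q : ℕ}
    (Q : Fin q → ι) : Matrix (Fin q) ι ℂ :=
  ((Real.sqrt ((Fintype.card ι : ℝ) / (q : ℝ)) : ℝ) : ℂ) • Φ.submatrix Q id

/-- The restricted isometry property of order `k` with constant `ε` on the support set `S`:
`(1 - ε) ‖x‖₂² ≤ ‖H x‖₂² ≤ (1 + ε) ‖x‖₂²` for every `k`-sparse `x` supported on `S`. -/
def HasRIPOn {m ι : Type*} [Fintype m] [Fintype ι] (H : Matrix m ι ℂ) (k : ℕ) (S : Finset ι)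
    (ε : ℝ) : Prop :=
  ∀ x : ι → ℂ, Function.support x ⊆ (S : Set ι) → (Function.support x).ncard ≤ k →
    (1 - ε) * ‖WithLp.toLp 2 x‖ ^ 2 ≤ ‖WithLp.toLp 2 (H.mulVec x)‖ ^ 2 ∧
      ‖WithLp.toLp 2 (H.mulVec x)‖ ^ 2 ≤ (1 + ε) * ‖WithLp.toLp 2 x‖ ^ 2

/-- The row-subsampled syndrome matrix restricted to the columns in `S`: its entry at `(j, b)` is
`β(Q j, b)`, read as one of the real numbers `0` and `1`. -/
def syndromeMatrix {A : Type*} [AddCommGroup A] [Module (ZMod 2) A]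
    (β : LinearMap.BilinForm (ZMod 2) A) (S : Finset A) {q : ℕ} (Q : Fin q → A) :
    Matrix (Fin q) S ℝ :=
  Matrix.of fun j b => ((β (Q j) b).val : ℝ)

/-- The probability that a sequence of `q` independent uniform samples (with replacement) from the
finite non-empty type `X` satisfies `E`. -/
noncomputable def sampleProb (X : Type*) (q : ℕ) (E : (Fin q → X) → Prop) : ℝ :=
  (Nat.card {Q : Fin q → X // E Q} : ℝ) / (Nat.card X : ℝ) ^ q

/-- The sample size
`δK⁻² K max(log²(K / δK) log²(1 / δK) log K, log (1 / δ))` (without its constant factor). -/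
noncomputable def sampleSize (K : ℕ) (δK δ : ℝ) : ℝ :=
  (δK ^ 2)⁻¹ * K *
    max (Real.log (K / δK) ^ 2 * Real.log (1 / δK) ^ 2 * Real.log K) (Real.log (1 / δ))

/-! ### Trace inequalities for Hermitian matrices -/

section

open Matrix Finset
open scoped ComplexOrder

/-! On a set of `K + 1` columns, sparsity of order `K + 1` is automatic. The RIP there only says
that one Hermitian matrix of size `K + 1`, the Gram matrix of these columns minus the identity, has
operator norm at most `δK`. This matrix is `1/q` times a sum `S` of independent copies of `Z = y* y
- 1`, where `y` is a random row rescaled by `√N`. Orthogonality of the columns makes `Z` centred,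
and the bound on the entries gives `‖y‖² ≤ L = B² (K + 1)`.

The norm of `S` is controlled by the moments `E tr S^(2P)`, using exchangeable pairs: resampling one
entry of the sample and a mean value inequality for traces (`Matrix.trace_mul_sub_pow_le`) bound
each even moment by the previous one (`sum_trace_pow_add_two_le`). Markov's inequality with `P`
about `log ((K + 1) / δ)` concludes. No union over supports is needed, so `q` of order `δK⁻² K log
((K + 1) / δ)` is enough; the further logarithms in `sampleSize` are slack.

For Walsh–Hadamard rows drawn from `M`, distinct syndromes are distinct characters of `M`, so the
columns stay orthogonal on `M`. Full rank follows from `(-1)^β = 1 - 2β`: a kernel vector of the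
syndrome matrix, completed by a suitable entry at the identity, is a kernel vector of `H`. -/

theorem Matrix.IsHermitian.exists_pow_eq_conj_diagonal {n : Type*} [Fintype n] [DecidableEq n]
    {A : Matrix n n ℂ} (hA : A.IsHermitian) :
    ∃ (U : Matrix n n ℂ) (a : n → ℝ), U * Uᴴ = 1 ∧ Uᴴ * U = 1 ∧
      ∀ k : ℕ, A ^ k = U * diagonal (fun i => ((a i : ℝ) : ℂ) ^ k) * Uᴴ := by
  set U : Matrix n n ℂ := (hA.eigenvectorUnitary : Matrix n n ℂ) with hU
  have h1 : U * Uᴴ = 1 := Unitary.coe_mul_star_self hA.eigenvectorUnitary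
  have h2 : Uᴴ * U = 1 := Unitary.coe_star_mul_self hA.eigenvectorUnitary
  have hs : A = U * diagonal (fun i => ((hA.eigenvalues i : ℝ) : ℂ)) * Uᴴ := by
    have := hA.spectral_theorem
    rw [Unitary.conjStarAlgAut_apply] at this
    exact this
  generalize hA.eigenvalues = a at hs
  refine ⟨U, a, h1, h2, fun k => ?_⟩
  induction k with
  | zero => simp [h1]
  | succ k ih =>
    have hd : diagonal (fun i => ((a i : ℝ) : ℂ) ^ (k + 1)) =
        diagonal (fun i => ((a i : ℝ) : ℂ) ^ k) *
          diagonal (fun i => ((a i : ℝ) : ℂ)) := by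
      rw [diagonal_mul_diagonal]; simp only [pow_succ]
    rw [pow_succ, ih, hd]
    nth_rw 1 [hs]
    calc _ = U * diagonal (fun i => ((a i : ℝ) : ℂ) ^ k) * (Uᴴ * U) *
          diagonal (fun i => ((a i : ℝ) : ℂ)) * Uᴴ := by simp only [Matrix.mul_assoc]
      _ = _ := by rw [h2]; simp only [Matrix.mul_assoc, Matrix.one_mul]

/-- Pair `j` with `r - j`: the differences `|a|^j - |b|^j` and `|a|^(r-j) - |b|^(r-j)` have the same
sign, so their product is nonnegative. Evenness of `r` removes the absolute values from `a^r` and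
`b^r`. -/
theorem sum_range_pow_mul_pow_le {r : ℕ} (hr : Even r) (a b : ℝ) :
    ∑ j ∈ range (r + 1), a ^ j * b ^ (r - j) ≤ (r + 1) / 2 * (a ^ r + b ^ r) := by
  have key : ∀ j ∈ range (r + 1), a ^ j * b ^ (r - j) + a ^ (r - j) * b ^ j ≤ a ^ r + b ^ r := by
    intro j hj
    have hjr : j ≤ r := Nat.lt_succ_iff.mp (mem_range.mp hj)
    have h0 : 0 ≤ (|a| ^ j - |b| ^ j) * (|a| ^ (r - j) - |b| ^ (r - j)) := by
      rcases le_total |a| |b| with h | h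
      · exact mul_nonneg_of_nonpos_of_nonpos
          (sub_nonpos.2 (pow_le_pow_left₀ (abs_nonneg _) h _))
          (sub_nonpos.2 (pow_le_pow_left₀ (abs_nonneg _) h _))
      · exact mul_nonneg (sub_nonneg.2 (pow_le_pow_left₀ (abs_nonneg _) h _))
          (sub_nonneg.2 (pow_le_pow_left₀ (abs_nonneg _) h _))
    have h1 : |a| ^ j * |a| ^ (r - j) = a ^ r := by
      rw [← pow_add, Nat.add_sub_cancel' hjr, hr.pow_abs]
    have h2 : |b| ^ j * |b| ^ (r - j) = b ^ r := by
      rw [← pow_add, Nat.add_sub_cancel' hjr, hr.pow_abs]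
    have h3 : a ^ j * b ^ (r - j) ≤ |a| ^ j * |b| ^ (r - j) := by
      rw [← abs_pow, ← abs_pow, ← abs_mul]; exact le_abs_self _
    have h4 : a ^ (r - j) * b ^ j ≤ |a| ^ (r - j) * |b| ^ j := by
      rw [← abs_pow, ← abs_pow, ← abs_mul]; exact le_abs_self _
    nlinarith
  have hrefl : ∑ j ∈ range (r + 1), a ^ (r - j) * b ^ j =
      ∑ j ∈ range (r + 1), a ^ j * b ^ (r - j) := by
    rw [← sum_range_reflect]
    refine sum_congr rfl fun j hj => ?_
    have hjr : j ≤ r := Nat.lt_succ_iff.mp (mem_range.mp hj)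
    congr 2; omega
  have := sum_le_sum key
  rw [sum_add_distrib, hrefl, sum_const, card_range, nsmul_eq_mul] at this
  push_cast at this
  linarith

/-- In eigenbases of the two matrices the trace becomes a sum with nonnegative weights, so that
scalar inequalities between eigenvalues pass to traces although the matrices need not commute. -/
theorem Matrix.trace_mul_conj_diagonal {n : Type*} [Fintype n] [DecidableEq n]
    {X : Matrix n n ℂ} (hX : X.IsHermitian) (U W : Matrix n n ℂ) (a b : n → ℝ) (k l : ℕ) :
    (X * (U * diagonal (fun i => ((a i : ℝ) : ℂ) ^ k) * Uᴴ) * X *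
      (W * diagonal (fun i => ((b i : ℝ) : ℂ) ^ l) * Wᴴ)).trace.re =
    ∑ i, ∑ j, Complex.normSq ((Wᴴ * X * U) i j) * (a j ^ k * b i ^ l) := by
  have h1 : (X * (U * diagonal (fun i => ((a i : ℝ) : ℂ) ^ k) * Uᴴ) * X *
      (W * diagonal (fun i => ((b i : ℝ) : ℂ) ^ l) * Wᴴ)).trace =
      ((Wᴴ * X * U) * diagonal (fun i => ((a i : ℝ) : ℂ) ^ k) * (Wᴴ * X * U)ᴴ *
        diagonal (fun i => ((b i : ℝ) : ℂ) ^ l)).trace := by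
    rw [conjTranspose_mul, conjTranspose_mul, conjTranspose_conjTranspose, hX.eq]
    rw [← Matrix.mul_assoc, trace_mul_comm]
    simp only [Matrix.mul_assoc]
  rw [h1]
  set V := Wᴴ * X * U
  simp only [trace, diag_apply, mul_diagonal, Matrix.mul_apply (M := V * _), conjTranspose_apply,
    Complex.re_sum, sum_mul]
  refine sum_congr rfl fun i _ => sum_congr rfl fun j _ => ?_
  have : V i j * (a j : ℂ) ^ k * star (V i j) * (b i : ℂ) ^ l =
      ((Complex.normSq (V i j) * (a j ^ k * b i ^ l) : ℝ) : ℂ) := by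
    push_cast
    rw [← Complex.mul_conj]
    simp only [Complex.star_def]
    ring
  rw [this, Complex.ofReal_re]

theorem Matrix.sum_trace_mul_pow_mul_pow_le {n : Type*} [Fintype n] [DecidableEq n]
    {A B X : Matrix n n ℂ} (hA : A.IsHermitian) (hB : B.IsHermitian) (hX : X.IsHermitian)
    {r : ℕ} (hr : Even r) :
    ∑ j ∈ range (r + 1), (X * A ^ j * X * B ^ (r - j)).trace.re ≤
      (r + 1) / 2 * ((X * X * A ^ r).trace.re + (X * X * B ^ r).trace.re) := by
  obtain ⟨U, a, hU, hU', hAk⟩ := hA.exists_pow_eq_conj_diagonal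
  obtain ⟨W, b, hW, hW', hBk⟩ := hB.exists_pow_eq_conj_diagonal
  have e1 : (X * X * A ^ r).trace = (X * A ^ r * X * B ^ 0).trace := by
    rw [pow_zero, Matrix.mul_one, Matrix.mul_assoc, trace_mul_comm]
  have e2 : X * X * B ^ r = X * A ^ 0 * X * B ^ r := by
    rw [pow_zero, Matrix.mul_one]
  rw [e1, e2]
  simp only [hAk, hBk, trace_mul_conj_diagonal hX]
  simp only [pow_zero, mul_one, one_mul]
  rw [sum_comm, ← sum_add_distrib, mul_sum]
  refine sum_le_sum fun i _ => ?_
  rw [sum_comm, ← sum_add_distrib, mul_sum]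
  refine sum_le_sum fun j _ => ?_
  rw [← mul_sum, ← mul_add]
  have := mul_le_mul_of_nonneg_left (sum_range_pow_mul_pow_le hr (a j) (b i))
    (Complex.normSq_nonneg ((Wᴴ * X * U) i j))
  linarith

theorem pow_succ_sub_pow_succ_eq_sum {R : Type*} [Ring R] (a b : R) (r : ℕ) :
    a ^ (r + 1) - b ^ (r + 1) = ∑ j ∈ range (r + 1), a ^ j * (a - b) * b ^ (r - j) := by
  induction r with
  | zero => simp
  | succ r ih =>
    rw [sum_range_succ', pow_zero, one_mul, Nat.sub_zero]
    have : ∑ j ∈ range (r + 1), a ^ (j + 1) * (a - b) * b ^ (r + 1 - (j + 1)) =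
        a * ∑ j ∈ range (r + 1), a ^ j * (a - b) * b ^ (r - j) := by
      rw [mul_sum]
      refine sum_congr rfl fun j _ => ?_
      rw [pow_succ' a j, Nat.add_sub_add_right]
      simp only [mul_assoc]
    rw [this, ← ih, pow_succ' a (r + 1), pow_succ' b (r + 1)]
    noncomm_ring

/-- A mean value inequality: telescoping the difference of powers without commutativity reduces it
to the mixed traces above. -/
theorem Matrix.trace_mul_sub_pow_le {n : Type*} [Fintype n] [DecidableEq n]
    {A B : Matrix n n ℂ} (hA : A.IsHermitian) (hB : B.IsHermitian) {r : ℕ} (hr : Even r) :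
    ((A - B) * (A ^ (r + 1) - B ^ (r + 1))).trace.re ≤
      (r + 1) / 2 * (((A - B) * (A - B) * A ^ r).trace.re +
        ((A - B) * (A - B) * B ^ r).trace.re) := by
  rw [pow_succ_sub_pow_succ_eq_sum, mul_sum, trace_sum, Complex.re_sum]
  simp only [← Matrix.mul_assoc]
  exact sum_trace_mul_pow_mul_pow_le hA hB (hA.sub hB) hr

theorem Matrix.PosSemidef.trace_mul_even_pow_nonneg {n : Type*} [Fintype n] [DecidableEq n]
    {T A : Matrix n n ℂ} (hT : T.PosSemidef) (hA : A.IsHermitian) {r : ℕ} (hr : Even r) :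
    0 ≤ (T * A ^ r).trace.re := by
  obtain ⟨s, rfl⟩ := hr
  have h : (T * A ^ (s + s)).trace = ((A ^ s)ᴴ * T * A ^ s).trace := by
    rw [(hA.pow s).eq, pow_add, ← Matrix.mul_assoc, trace_mul_comm, Matrix.mul_assoc]
  rw [h]
  exact (Complex.le_def.1 (hT.conjTranspose_mul_mul_same (A ^ s)).trace_nonneg).1

/-- Expand `tr ((A - c)² A^r) ≥ 0`. This absorbs the odd moment that appears in the moment
recursion. -/
theorem Matrix.IsHermitian.trace_pow_succ_le {n : Type*} [Fintype n] [DecidableEq n]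
    {A : Matrix n n ℂ} (hA : A.IsHermitian) {r : ℕ} (hr : Even r) (c : ℝ) :
    2 * c * (A ^ (r + 1)).trace.re ≤ (A ^ (r + 2)).trace.re + c ^ 2 * (A ^ r).trace.re := by
  have hc : ((c : ℂ) • (1 : Matrix n n ℂ)).IsHermitian := by
    simp [IsHermitian, conjTranspose_smul]
  have hT : ((A - (c : ℂ) • 1) * (A - (c : ℂ) • 1)).PosSemidef := by
    have := posSemidef_conjTranspose_mul_self (A - (c : ℂ) • 1)
    rwa [(hA.sub hc).eq] at this
  have h := hT.trace_mul_even_pow_nonneg hA hr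
  have e : (A - (c : ℂ) • 1) * (A - (c : ℂ) • 1) * A ^ r =
      A ^ (r + 2) - ((2 * c : ℝ) : ℂ) • A ^ (r + 1) + ((c ^ 2 : ℝ) : ℂ) • A ^ r := by
    rw [pow_succ' A (r + 1), pow_succ' A r]
    simp only [Matrix.sub_mul, Matrix.mul_sub, Matrix.smul_mul, Matrix.mul_smul, Matrix.one_mul,
      Matrix.mul_one, Matrix.mul_assoc]
    push_cast
    module
  rw [e, trace_add, trace_sub, trace_smul, trace_smul] at h
  simp only [Complex.add_re, Complex.sub_re, smul_eq_mul, Complex.re_ofReal_mul] at h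
  linarith

/-- Each eigenvalue to the power `2P` is at most the sum of all of them, which is the trace. -/
theorem Matrix.IsHermitian.abs_re_dotProduct_mulVec_le {n : Type*} [Fintype n] [DecidableEq n]
    {A : Matrix n n ℂ} (hA : A.IsHermitian) {P : ℕ} (hP : P ≠ 0) {t : ℝ} (ht : 0 ≤ t)
    (htr : (A ^ (2 * P)).trace.re ≤ t ^ (2 * P)) (v : n → ℂ) :
    |(star v ⬝ᵥ A *ᵥ v).re| ≤ t * ∑ b, Complex.normSq (v b) := by
  obtain ⟨U, a, hU, hU', hAk⟩ := hA.exists_pow_eq_conj_diagonal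
  have hae : ∑ i, a i ^ (2 * P) = (A ^ (2 * P)).trace.re := by
    rw [hAk, trace_mul_comm, ← Matrix.mul_assoc, hU', Matrix.one_mul, trace_diagonal,
      Complex.re_sum]
    refine sum_congr rfl fun i _ => ?_
    rw [← Complex.ofReal_pow, Complex.ofReal_re]
  have ha : ∀ i, |a i| ≤ t := fun i => by
    have h1 : a i ^ (2 * P) ≤ ∑ i, a i ^ (2 * P) :=
      single_le_sum (f := fun i => a i ^ (2 * P))
        (fun j _ => (even_two_mul P).pow_nonneg (a j)) (mem_univ i)
    rw [← (even_two_mul P).pow_abs] at h1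
    exact le_of_pow_le_pow_left₀ (by omega) ht (h1.trans (hae.le.trans htr))
  set w := Uᴴ *ᵥ v with hw
  have hq : ∀ f : n → ℝ, star v ⬝ᵥ (U * diagonal (fun i => (f i : ℂ)) * Uᴴ) *ᵥ v =
      ((∑ i, f i * Complex.normSq (w i) : ℝ) : ℂ) := by
    intro f
    have hsw : star w = star v ᵥ* U := by rw [hw, star_mulVec, conjTranspose_conjTranspose]
    rw [← mulVec_mulVec, ← mulVec_mulVec, dotProduct_mulVec, ← hsw, ← hw]
    simp only [dotProduct, mulVec_diagonal, Pi.star_apply]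
    push_cast
    refine sum_congr rfl fun i _ => ?_
    rw [← Complex.mul_conj, Complex.star_def]
    ring
  have hnorm : ∑ b, Complex.normSq (v b) = ∑ i, Complex.normSq (w i) := by
    have h := hq (fun _ => 1)
    have h1 : diagonal (fun _ : n => ((1 : ℝ) : ℂ)) = 1 := by simp
    rw [h1, Matrix.mul_one, hU, one_mulVec] at h
    have h2 : star v ⬝ᵥ v = ((∑ b, Complex.normSq (v b) : ℝ) : ℂ) := by
      simp only [dotProduct, Pi.star_apply]
      push_cast
      refine sum_congr rfl fun i _ => ?_
      rw [← Complex.mul_conj, Complex.star_def, mul_comm]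
    rw [h2] at h
    simpa using Complex.ofReal_injective h
  have hA1 := hAk 1
  simp only [pow_one] at hA1
  rw [hA1, hq, Complex.ofReal_re, hnorm, mul_sum]
  refine (abs_sum_le_sum_abs _ _).trans (sum_le_sum fun i _ => ?_)
  rw [abs_mul, abs_of_nonneg (Complex.normSq_nonneg _)]
  exact mul_le_mul_of_nonneg_right (ha i) (Complex.normSq_nonneg _)
end
-- Moments of a sum of independent centred matrices, by exchangeable pairs
section

open Matrix Finset
open scoped ComplexOrder

variable {X n : Type*}

/-- The sum of the values of `Z` along a sample `Q`. -/
def sampleSum (Z : X → Matrix n n ℂ) {q : ℕ} (Q : Fin q → X) : Matrix n n ℂ :=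
  ∑ i, Z (Q i)

theorem sampleSum_isHermitian {Z : X → Matrix n n ℂ} (hZ : ∀ x, (Z x).IsHermitian) {q : ℕ}
    (Q : Fin q → X) : (sampleSum Z Q).IsHermitian := by
  unfold sampleSum IsHermitian
  rw [conjTranspose_sum]
  exact sum_congr rfl fun i _ => hZ _

theorem sampleSum_sub_update (Z : X → Matrix n n ℂ) {q : ℕ} (Q : Fin q → X) (i : Fin q) (x : X) :
    sampleSum Z Q - sampleSum Z (Function.update Q i x) = Z (Q i) - Z x := by
  unfold sampleSum
  rw [← sum_sub_distrib, sum_eq_single i]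
  · simp
  · intro j _ hj
    simp [Function.update_of_ne hj]
  · simp

variable [Fintype X]

/-- Swapping the `i`-th entry of a sample with an independent copy preserves averages. -/
theorem sum_sum_swap {q : ℕ} (i : Fin q) (f : (Fin q → X) → X → ℝ) :
    ∑ Q : Fin q → X, ∑ x, f Q x = ∑ Q : Fin q → X, ∑ x, f (Function.update Q i x) (Q i) := by
  classical
  rw [← Fintype.sum_prod_type', ← Fintype.sum_prod_type']
  refine Fintype.sum_bijective (fun p : (Fin q → X) × X => (Function.update p.1 i p.2, p.1 i))
    (Function.Involutive.bijective fun p => ?_) _ _ fun p => ?_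
  · simp
  · simp

variable [Fintype n] [DecidableEq n]

/-- Since `Z` is centred, `Z (Q i)` may be replaced by `D = Z (Q i) - Z x` with `x` an independent
copy. Swapping `Q i` and `x` negates `D` and turns the sum `S` into `S' = S - D`, so the left side
is half the sum of `tr (D (S^(r+1) - S'^(r+1)))`, to which the mean value inequality applies. -/
theorem sum_trace_mul_pow_le {Z : X → Matrix n n ℂ} (hZ : ∀ x, (Z x).IsHermitian)
    (h0 : ∑ x, Z x = 0) {q r : ℕ} (hr : Even r) (i : Fin q) :
    (Fintype.card X : ℝ) * ∑ Q : Fin q → X, (Z (Q i) * sampleSum Z Q ^ (r + 1)).trace.re ≤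
      (r + 1) / 2 * ∑ Q : Fin q → X,
        ((((Fintype.card X : ℂ) • (Z (Q i) * Z (Q i)) + ∑ x, Z x * Z x) *
          sampleSum Z Q ^ r).trace.re) := by
  have hS := fun Q : Fin q → X => sampleSum_isHermitian hZ Q
  have e1 : (Fintype.card X : ℝ) *
        ∑ Q : Fin q → X, (Z (Q i) * sampleSum Z Q ^ (r + 1)).trace.re =
      ∑ Q : Fin q → X, ∑ x, ((Z (Q i) - Z x) * sampleSum Z Q ^ (r + 1)).trace.re := by
    rw [mul_sum]
    refine sum_congr rfl fun Q _ => ?_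
    rw [← Complex.re_sum, ← trace_sum, ← sum_mul, sum_sub_distrib, h0, sub_zero, sum_const,
      card_univ, smul_mul_assoc, trace_smul, nsmul_eq_mul, ← Complex.ofReal_natCast,
      Complex.re_ofReal_mul]
  have e2 : ∑ Q : Fin q → X, ∑ x, ((Z (Q i) - Z x) * sampleSum Z Q ^ (r + 1)).trace.re =
      -∑ Q : Fin q → X, ∑ x, ((Z (Q i) - Z x) *
        sampleSum Z (Function.update Q i x) ^ (r + 1)).trace.re := by
    rw [sum_sum_swap i, ← sum_neg_distrib]
    refine sum_congr rfl fun Q _ => ?_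
    rw [← sum_neg_distrib]
    refine sum_congr rfl fun x _ => ?_
    rw [Function.update_self, ← Complex.neg_re, ← trace_neg, ← Matrix.neg_mul, neg_sub]
  have e3 : ∑ Q : Fin q → X, ∑ x, ((Z (Q i) - Z x) * (Z (Q i) - Z x) *
        sampleSum Z (Function.update Q i x) ^ r).trace.re =
      ∑ Q : Fin q → X, ∑ x, ((Z (Q i) - Z x) * (Z (Q i) - Z x) *
        sampleSum Z Q ^ r).trace.re := by
    rw [sum_sum_swap i (fun Q x => ((Z (Q i) - Z x) * (Z (Q i) - Z x) *
        sampleSum Z Q ^ r).trace.re)]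
    refine sum_congr rfl fun Q _ => sum_congr rfl fun x _ => ?_
    rw [Function.update_self, ← neg_sub (Z x) (Z (Q i)), neg_mul_neg]
  have e4 : ∀ Q : Fin q → X, ∑ x, ((Z (Q i) - Z x) * (Z (Q i) - Z x) *
        sampleSum Z Q ^ r).trace.re =
      ((((Fintype.card X : ℂ) • (Z (Q i) * Z (Q i)) + ∑ x, Z x * Z x) *
          sampleSum Z Q ^ r).trace.re) := by
    intro Q
    rw [← Complex.re_sum, ← trace_sum, ← sum_mul]
    congr 4
    have : ∀ x, (Z (Q i) - Z x) * (Z (Q i) - Z x) =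
        Z (Q i) * Z (Q i) - Z (Q i) * Z x - Z x * Z (Q i) + Z x * Z x := fun x => by
      noncomm_ring
    simp only [this]
    have hl : ∑ x, Z (Q i) * Z x = 0 := by rw [← mul_sum, h0, mul_zero]
    have hr : ∑ x, Z x * Z (Q i) = 0 := by rw [← sum_mul, h0, zero_mul]
    rw [sum_add_distrib, sum_sub_distrib, sum_sub_distrib, hl, hr, sub_zero, sub_zero, sum_const,
      card_univ, Nat.cast_smul_eq_nsmul]
  have e5 : ∑ Q : Fin q → X, ∑ x, ((Z (Q i) - Z x) * (sampleSum Z Q ^ (r + 1) -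
        sampleSum Z (Function.update Q i x) ^ (r + 1))).trace.re ≤
      ∑ Q : Fin q → X, ∑ x, (r + 1) / 2 * (((Z (Q i) - Z x) * (Z (Q i) - Z x) *
        sampleSum Z Q ^ r).trace.re + ((Z (Q i) - Z x) * (Z (Q i) - Z x) *
        sampleSum Z (Function.update Q i x) ^ r).trace.re) := by
    refine sum_le_sum fun Q _ => sum_le_sum fun x _ => ?_
    have := trace_mul_sub_pow_le (hS Q) (hS (Function.update Q i x)) hr
    rwa [sampleSum_sub_update] at this
  simp only [Matrix.mul_sub, trace_sub, Complex.sub_re, sum_sub_distrib, ← mul_sum,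
    sum_add_distrib] at e5
  simp only [← Matrix.mul_sub] at e5
  rw [e3] at e5
  simp only [e4] at e5
  linarith

/-- Keeping the term `L Z` in the bound on `Z²`, instead of a crude bound of order `L²`, makes the
main term `q L` and not `q L²`. Summed over the sample, these linear terms rebuild `S` and produce a
moment of order `r + 1`. -/
theorem sum_trace_pow_add_two_le {Z : X → Matrix n n ℂ} (hZ : ∀ x, (Z x).IsHermitian)
    (h0 : ∑ x, Z x = 0) [Nonempty X] {L : ℝ}
    (h1 : ∀ x, ((L : ℂ) • Z x + ((L + 1 : ℝ) : ℂ) • 1 - Z x * Z x).PosSemidef)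
    (h2 : (((Fintype.card X * (L - 1) : ℝ) : ℂ) • 1 - ∑ x, Z x * Z x).PosSemidef)
    {q r : ℕ} (hr : Even r) :
    ∑ Q : Fin q → X, (sampleSum Z Q ^ (r + 2)).trace.re ≤
      ((r + 1) ^ 2 * L ^ 2 / 4 + 2 * (r + 1) * q * L) *
        ∑ Q : Fin q → X, (sampleSum Z Q ^ r).trace.re := by
  have hS := fun Q : Fin q → X => sampleSum_isHermitian hZ Q
  have hN : (0 : ℝ) < Fintype.card X := by exact_mod_cast Fintype.card_pos
  have e1 : ∀ Q : Fin q → X, ∑ i, (Z (Q i) * sampleSum Z Q ^ (r + 1)).trace.re =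
      (sampleSum Z Q ^ (r + 2)).trace.re := by
    intro Q
    rw [← Complex.re_sum, ← trace_sum, ← sum_mul, pow_succ' _ (r + 1)]
    rfl
  have e2 : ∀ (Q : Fin q → X) (i : Fin q),
      ((((Fintype.card X : ℂ) • (Z (Q i) * Z (Q i)) + ∑ x, Z x * Z x) *
          sampleSum Z Q ^ r).trace.re) ≤
      Fintype.card X * (L * (Z (Q i) * sampleSum Z Q ^ r).trace.re +
        2 * L * (sampleSum Z Q ^ r).trace.re) := by
    intro Q i
    have a1 := (h1 (Q i)).trace_mul_even_pow_nonneg (hS Q) hr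
    have a2 := h2.trace_mul_even_pow_nonneg (hS Q) hr
    rw [← Complex.ofReal_natCast]
    simp only [Matrix.sub_mul, Matrix.add_mul, Matrix.smul_mul, Matrix.one_mul, trace_sub,
      trace_add, trace_smul, smul_eq_mul, Complex.sub_re, Complex.add_re,
      Complex.re_ofReal_mul] at a1 a2 ⊢
    nlinarith [mul_nonneg hN.le a1]
  have e3 : (Fintype.card X : ℝ) * ∑ Q : Fin q → X, (sampleSum Z Q ^ (r + 2)).trace.re ≤
      Fintype.card X * ((r + 1) / 2 * (L * ∑ Q : Fin q → X, (sampleSum Z Q ^ (r + 1)).trace.re +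
        2 * L * q * ∑ Q : Fin q → X, (sampleSum Z Q ^ r).trace.re)) := by
    calc _ = ∑ i, (Fintype.card X : ℝ) *
          ∑ Q : Fin q → X, (Z (Q i) * sampleSum Z Q ^ (r + 1)).trace.re := by
          simp only [← e1]
          rw [sum_comm, mul_sum]
      _ ≤ ∑ i : Fin q, (r + 1) / 2 * ∑ Q : Fin q → X,
          Fintype.card X * (L * (Z (Q i) * sampleSum Z Q ^ r).trace.re +
            2 * L * (sampleSum Z Q ^ r).trace.re) := by
          refine sum_le_sum fun i _ => (sum_trace_mul_pow_le hZ h0 hr i).trans ?_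
          exact mul_le_mul_of_nonneg_left (sum_le_sum fun Q _ => e2 Q i) (by positivity)
      _ = _ := by
          have e4 : ∀ Q : Fin q → X, ∑ i, (Z (Q i) * sampleSum Z Q ^ r).trace.re =
              (sampleSum Z Q ^ (r + 1)).trace.re := by
            intro Q
            rw [← Complex.re_sum, ← trace_sum, ← sum_mul, pow_succ' _ r]
            rfl
          rw [← mul_sum, sum_comm]
          simp only [← mul_sum, sum_add_distrib, e4, sum_const, card_univ, Fintype.card_fin,
            nsmul_eq_mul]
          ring
  have e5 := le_of_mul_le_mul_left e3 hN
  -- With `c = (r + 1) L / 2`, the coefficient of the odd moment in `e5`, half of the moment of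
  -- order `r + 2` is absorbed into the left side.
  have e6 : 2 * ((r + 1) * L / 2) * ∑ Q : Fin q → X, (sampleSum Z Q ^ (r + 1)).trace.re ≤
      ∑ Q : Fin q → X, (sampleSum Z Q ^ (r + 2)).trace.re +
        ((r + 1) * L / 2) ^ 2 * ∑ Q : Fin q → X, (sampleSum Z Q ^ r).trace.re := by
    rw [mul_sum, mul_sum, ← sum_add_distrib]
    exact sum_le_sum fun Q _ => (hS Q).trace_pow_succ_le hr _
  nlinarith

theorem sum_trace_pow_two_mul_le {Z : X → Matrix n n ℂ} (hZ : ∀ x, (Z x).IsHermitian)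
    (h0 : ∑ x, Z x = 0) [Nonempty X] {L : ℝ} (hL : 0 ≤ L)
    (h1 : ∀ x, ((L : ℂ) • Z x + ((L + 1 : ℝ) : ℂ) • 1 - Z x * Z x).PosSemidef)
    (h2 : (((Fintype.card X * (L - 1) : ℝ) : ℂ) • 1 - ∑ x, Z x * Z x).PosSemidef)
    (q P : ℕ) :
    ∑ Q : Fin q → X, (sampleSum Z Q ^ (2 * P)).trace.re ≤
      (P ^ 2 * L ^ 2 + 4 * P * q * L) ^ P * (Fintype.card n * (Fintype.card X : ℝ) ^ q) := by
  have hS := fun Q : Fin q → X => sampleSum_isHermitian hZ Q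
  have key : ∀ k ≤ P, ∑ Q : Fin q → X, (sampleSum Z Q ^ (2 * k)).trace.re ≤
      (P ^ 2 * L ^ 2 + 4 * P * q * L) ^ k * (Fintype.card n * (Fintype.card X : ℝ) ^ q) := by
    intro k
    induction k with
    | zero =>
      intro _
      simp [trace_one, mul_comm]
    | succ k ih =>
      intro hk
      have hnn : 0 ≤ ∑ Q : Fin q → X, (sampleSum Z Q ^ (2 * k)).trace.re := by
        refine sum_nonneg fun Q _ => ?_
        have := PosSemidef.one.trace_mul_even_pow_nonneg (hS Q) (even_two_mul k)
        rwa [Matrix.one_mul] at this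
      have hkP : ((2 * k : ℕ) : ℝ) + 1 ≤ 2 * P := by
        have : 2 * k + 1 ≤ 2 * P := by omega
        exact_mod_cast this
      have hk0 : (0 : ℝ) ≤ ((2 * k : ℕ) : ℝ) + 1 := by positivity
      -- From `2k + 1 ≤ 2P`, one factor serves all `P` steps of the recursion.
      have hc : (((2 * k : ℕ) : ℝ) + 1) ^ 2 * L ^ 2 / 4 + 2 * (((2 * k : ℕ) : ℝ) + 1) * q * L ≤
          P ^ 2 * L ^ 2 + 4 * P * q * L := by
        have t1 : (((2 * k : ℕ) : ℝ) + 1) ^ 2 ≤ (2 * P) ^ 2 := pow_le_pow_left₀ hk0 hkP 2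
        have t2 := mul_le_mul_of_nonneg_right t1 (sq_nonneg L)
        have t3 := mul_le_mul_of_nonneg_right hkP (by positivity : 0 ≤ 2 * (q * L))
        nlinarith
      calc _ ≤ _ := sum_trace_pow_add_two_le hZ h0 h1 h2 (even_two_mul k)
        _ ≤ _ := mul_le_mul_of_nonneg_right hc hnn
        _ ≤ _ := mul_le_mul_of_nonneg_left (ih (by omega)) (by positivity)
        _ = _ := by ring
  exact key P le_rfl

theorem card_mul_le_of_trace_pow {Z : X → Matrix n n ℂ} (hZ : ∀ x, (Z x).IsHermitian)
    (h0 : ∑ x, Z x = 0) [Nonempty X] {L : ℝ} (hL : 0 ≤ L)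
    (h1 : ∀ x, ((L : ℂ) • Z x + ((L + 1 : ℝ) : ℂ) • 1 - Z x * Z x).PosSemidef)
    (h2 : (((Fintype.card X * (L - 1) : ℝ) : ℂ) • 1 - ∑ x, Z x * Z x).PosSemidef)
    {q P : ℕ} (hq : 0 < q) {ε : ℝ} (hε : 0 < ε) (hε1 : ε ≤ 1) (hqP : 12 * P * L ≤ q * ε ^ 2) :
    (#{Q : Fin q → X | ¬ (sampleSum Z Q ^ (2 * P)).trace.re ≤ (q * ε) ^ (2 * P)} : ℝ) ≤
      Fintype.card n * Real.exp (-P) * (Fintype.card X : ℝ) ^ q := by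
  have hS := fun Q : Fin q → X => sampleSum_isHermitian hZ Q
  have hq' : (0 : ℝ) < q := by exact_mod_cast hq
  set t : ℝ := q * ε with ht
  have htp : 0 < t := by positivity
  have hm := sum_trace_pow_two_mul_le hZ h0 hL h1 h2 q P
  have hnn : ∀ Q : Fin q → X, 0 ≤ (sampleSum Z Q ^ (2 * P)).trace.re := fun Q => by
    have := PosSemidef.one.trace_mul_even_pow_nonneg (hS Q) (even_two_mul P)
    rwa [Matrix.one_mul] at this
  have hmark : (#{Q : Fin q → X | ¬ (sampleSum Z Q ^ (2 * P)).trace.re ≤ t ^ (2 * P)} : ℝ) *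
      t ^ (2 * P) ≤ ∑ Q : Fin q → X, (sampleSum Z Q ^ (2 * P)).trace.re := by
    rw [← nsmul_eq_mul]
    refine (card_nsmul_le_sum _ _ _ fun Q hQ => ?_).trans
      (sum_le_sum_of_subset_of_nonneg (filter_subset _ _) fun Q _ _ => hnn Q)
    exact (not_le.1 (mem_filter.1 hQ).2).le
  -- As `P L ≤ q ε² / 12`, the left side is at most `(1/144 + 4/12) t² = (49/144) t²`, and `49/144 <
  -- 0.35 < 1/e`. Each moment step thus gains a factor `1/e` over Markov's threshold.
  have hb : P ^ 2 * L ^ 2 + 4 * P * q * L ≤ Real.exp (-1) * t ^ 2 := by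
    have hPL : 0 ≤ P * L := by positivity
    have hPLq : P * L ≤ q * ε ^ 2 / 12 := by linarith
    have u1 : (P * L) ^ 2 ≤ (q * ε ^ 2 / 12) ^ 2 := pow_le_pow_left₀ hPL hPLq 2
    have u2 : (ε ^ 2) ^ 2 ≤ ε ^ 2 := by
      have : ε ^ 2 ≤ 1 := pow_le_one₀ hε.le hε1
      nlinarith [sq_nonneg ε]
    have u3 := mul_le_mul_of_nonneg_left hPLq hq'.le
    have u4 : (35 / 100 : ℝ) ≤ Real.exp (-1) := by
      rw [Real.exp_neg, le_inv_comm₀ (by norm_num) (Real.exp_pos 1)]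
      exact Real.exp_one_lt_d9.le.trans (by norm_num)
    have u5 := mul_le_mul_of_nonneg_right u4 (sq_nonneg t)
    have u6 := mul_le_mul_of_nonneg_left u2 (sq_nonneg (q : ℝ))
    have u7 : t ^ 2 = q ^ 2 * ε ^ 2 := by rw [ht]; ring
    have u8 : 0 ≤ t ^ 2 := sq_nonneg t
    nlinarith
  have hpow : (P ^ 2 * L ^ 2 + 4 * P * q * L) ^ P ≤ Real.exp (-P) * t ^ (2 * P) := by
    refine (pow_le_pow_left₀ (by positivity) hb P).trans_eq ?_
    rw [mul_pow, ← pow_mul, ← Real.exp_nat_mul]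
    congr 2
    ring
  refine le_of_mul_le_mul_right (hmark.trans (hm.trans ?_)) (pow_pos htp (2 * P))
  calc _ ≤ _ := mul_le_mul_of_nonneg_right hpow (by positivity)
    _ = _ := by ring

end
-- Concentration of empirical second moments, and the sample size
section

open Matrix Finset
open scoped ComplexOrder

variable {X n : Type*} [Fintype X] [Fintype n] [DecidableEq n]

theorem vecMulVec_star_mul_self {n : Type*} [Fintype n] (y : n → ℂ) :
    vecMulVec (star y) y * vecMulVec (star y) y =
      ((∑ b, Complex.normSq (y b) : ℝ) : ℂ) • vecMulVec (star y) y := by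
  have h : y ⬝ᵥ star y = ((∑ b, Complex.normSq (y b) : ℝ) : ℂ) := by
    simp only [dotProduct, Pi.star_apply]
    push_cast
    refine sum_congr rfl fun i _ => ?_
    rw [← Complex.mul_conj, Complex.star_def]
  rw [vecMulVec_mul_vecMulVec, h, vecMulVec_smul]

/-- Concentration of the empirical second moments of bounded isotropic vectors. -/
theorem card_deviation_le [Nonempty X] (y : X → n → ℂ) {L : ℝ} (hL : 0 ≤ L)
    (hy : ∀ x, ∑ b, Complex.normSq (y x b) ≤ L)
    (hiso : ∑ x, vecMulVec (star (y x)) (y x) = (Fintype.card X : ℂ) • 1)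
    {q P : ℕ} (hq : 0 < q) (hP : P ≠ 0) {ε : ℝ} (hε : 0 < ε) (hε1 : ε ≤ 1)
    (hqP : 12 * P * L ≤ q * ε ^ 2) :
    ((Nat.card {Q : Fin q → X // ¬ ∀ v : n → ℂ,
      |∑ j, Complex.normSq (y (Q j) ⬝ᵥ v) - q * ∑ b, Complex.normSq (v b)| ≤
        q * ε * ∑ b, Complex.normSq (v b)} : ℕ) : ℝ) ≤
      Fintype.card n * Real.exp (-P) * (Fintype.card X : ℝ) ^ q := by
  classical
  set W : X → Matrix n n ℂ := fun x => vecMulVec (star (y x)) (y x) with hW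
  set Z : X → Matrix n n ℂ := fun x => W x - 1 with hZdef
  set s : X → ℝ := fun x => ∑ b, Complex.normSq (y x b) with hs
  have hWpos : ∀ x, (W x).PosSemidef := fun x => posSemidef_vecMulVec_star_self (y x)
  have hZ : ∀ x, (Z x).IsHermitian := fun x => (hWpos x).isHermitian.sub isHermitian_one
  have h0 : ∑ x, Z x = 0 := by
    simp only [hZdef]
    rw [sum_sub_distrib, hiso, sum_const, card_univ, Nat.cast_smul_eq_nsmul, sub_self]
  have hZZ : ∀ x, Z x * Z x = (s x : ℂ) • W x - (2 : ℂ) • W x + 1 := by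
    intro x
    have : W x * W x = (s x : ℂ) • W x := vecMulVec_star_mul_self (y x)
    simp only [hZdef, Matrix.sub_mul, Matrix.mul_sub, this, Matrix.one_mul, Matrix.mul_one]
    module
  have h1 : ∀ x, ((L : ℂ) • Z x + ((L + 1 : ℝ) : ℂ) • 1 - Z x * Z x).PosSemidef := by
    intro x
    -- `W` has rank at most one with `W² = s W`, so `Z² = (s - 2) W + 1`, and `s ≤ L` keeps the
    -- coefficient of `W` positive.
    have e : (L : ℂ) • Z x + ((L + 1 : ℝ) : ℂ) • 1 - Z x * Z x =
        ((L - s x + 2 : ℝ) : ℂ) • W x := by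
      rw [hZZ]
      simp only [hZdef]
      push_cast
      module
    rw [e]
    refine (hWpos x).smul ?_
    rw [Complex.zero_le_real]
    linarith [hy x]
  have h2 : (((Fintype.card X * (L - 1) : ℝ) : ℂ) • 1 - ∑ x, Z x * Z x).PosSemidef := by
    have e : ((Fintype.card X * (L - 1) : ℝ) : ℂ) • 1 - ∑ x, Z x * Z x =
        ∑ x, ((L - s x : ℝ) : ℂ) • W x := by
      simp only [hZZ, sum_add_distrib, sum_sub_distrib, Complex.ofReal_sub, sub_smul]
      rw [← smul_sum, ← smul_sum, hiso, sum_const, card_univ, ← Nat.cast_smul_eq_nsmul ℂ]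
      push_cast
      module
    rw [e]
    refine posSemidef_sum _ fun x _ => (hWpos x).smul ?_
    rw [Complex.zero_le_real]
    linarith [hy x]
  have hquad : ∀ (Q : Fin q → X) (v : n → ℂ), (star v ⬝ᵥ sampleSum Z Q *ᵥ v).re =
      ∑ j, Complex.normSq (y (Q j) ⬝ᵥ v) - q * ∑ b, Complex.normSq (v b) := by
    intro Q v
    have a1 : star v ⬝ᵥ v = ((∑ b, Complex.normSq (v b) : ℝ) : ℂ) := by
      simp only [dotProduct, Pi.star_apply]
      push_cast
      refine sum_congr rfl fun i _ => ?_
      rw [← Complex.mul_conj, Complex.star_def, mul_comm]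
    have a2 : ∀ x, star v ⬝ᵥ Z x *ᵥ v =
        ((Complex.normSq (y x ⬝ᵥ v) - ∑ b, Complex.normSq (v b) : ℝ) : ℂ) := by
      intro x
      simp only [hZdef, hW]
      rw [sub_mulVec, one_mulVec, dotProduct_sub, a1, vecMulVec_mulVec, op_smul_eq_smul,
        dotProduct_smul, star_dotProduct_star, smul_eq_mul, Complex.star_def, Complex.mul_conj]
      push_cast
      rfl
    unfold sampleSum
    rw [sum_mulVec, dotProduct_sum]
    simp only [a2, Complex.re_sum, Complex.ofReal_re]
    simp
  refine le_trans ?_ (card_mul_le_of_trace_pow hZ h0 hL h1 h2 hq hε hε1 hqP)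
  rw [Nat.cast_le, Nat.card_eq_fintype_card, Fintype.card_subtype]
  refine card_le_card fun Q hQ => ?_
  rw [mem_filter] at hQ ⊢
  refine ⟨mem_univ _, fun h => hQ.2 fun v => ?_⟩
  rw [← hquad]
  exact (sampleSum_isHermitian hZ Q).abs_re_dotProduct_mulVec_le hP (by positivity) h v

theorem one_sub_le_sampleProb {X : Type*} [Finite X] [Nonempty X] {q : ℕ} {E : (Fin q → X) → Prop} {δ : ℝ}
    (h : ((Nat.card {Q : Fin q → X // ¬ E Q} : ℕ) : ℝ) ≤ δ * (Nat.card X : ℝ) ^ q) :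
    1 - δ ≤ sampleProb X q E := by
  classical
  have := Fintype.ofFinite X
  have hN : (0 : ℝ) < (Nat.card X : ℝ) ^ q := by
    have : 0 < Nat.card X := Nat.card_pos
    positivity
  have hc : ((Nat.card {Q : Fin q → X // E Q} : ℕ) : ℝ) +
      ((Nat.card {Q : Fin q → X // ¬ E Q} : ℕ) : ℝ) = (Nat.card X : ℝ) ^ q := by
    have h3 : Fintype.card (Fin q → X) = Nat.card X ^ q := by simp
    rw [← Nat.cast_add, ← Nat.cast_pow, ← h3, Nat.card_eq_fintype_card, Nat.card_eq_fintype_card,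
      ← Fintype.card_congr (Equiv.sumCompl E), Fintype.card_sum]
  unfold sampleProb
  rw [le_div_iff₀ hN]
  linarith

theorem sampleProb_mono {X : Type*} [Finite X] {q : ℕ} {E F : (Fin q → X) → Prop}
    (h : ∀ Q, E Q → F Q) : sampleProb X q E ≤ sampleProb X q F := by
  unfold sampleProb
  gcongr
  exact Nat.card_le_card_of_injective (Subtype.map id h)
    (Subtype.map_injective h Function.injective_id)

/-- The failure probability and the sample size in terms of `K`, `δK` and `δ`. -/
theorem exists_exponent_of_sampleSize_le {B : ℝ} (hB : 0 < B) {K : ℕ} (hK : 1 ≤ K) {δK δ : ℝ}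
    (hδK : 0 < δK) (hδK1 : δK ≤ Real.exp (-1)) (hδ : 0 < δ) (hδ1 : δ < 1)
    (hKδ : 2 ≤ K ∨ δ ≤ 1 / 2) {q : ℕ} (hq : 120 * B ^ 2 * sampleSize K δK δ ≤ q) :
    ∃ P : ℕ, P ≠ 0 ∧ 0 < q ∧ (K + 1 : ℝ) * Real.exp (-P) ≤ δ ∧
      12 * P * (B ^ 2 * (K + 1)) ≤ q * δK ^ 2 := by
  have hK' : (1 : ℝ) ≤ K := by exact_mod_cast hK
  set M := max (Real.log (K / δK) ^ 2 * Real.log (1 / δK) ^ 2 * Real.log K) (Real.log (1 / δ))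
    with hM
  have hlogd : 0 < Real.log (1 / δ) := Real.log_pos ((one_lt_div hδ).2 hδ1)
  have hM2 : Real.log (1 / δ) ≤ M := le_max_right _ _
  have hlogK : 0 ≤ Real.log K := Real.log_nonneg hK'
  -- For `δK ≤ 1/e` both squared logarithms are at least one.
  have hM1 : Real.log K ≤ M := by
    refine le_trans ?_ (le_max_left _ _)
    have a1 : 1 ≤ Real.log (1 / δK) := by
      rw [one_div, Real.log_inv]
      have := Real.log_le_log hδK hδK1
      rw [Real.log_exp] at this
      linarith
    have a2 : 1 ≤ Real.log (K / δK) :=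
      a1.trans (Real.log_le_log (by positivity) (by gcongr))
    have a3 : 1 ≤ Real.log (K / δK) ^ 2 * Real.log (1 / δK) ^ 2 :=
      one_le_mul_of_one_le_of_one_le (one_le_pow₀ a2) (one_le_pow₀ a1)
    nlinarith
  have hlog2 : (0.69 : ℝ) ≤ Real.log 2 := by linarith [Real.log_two_gt_d9]
  have hlog2' : Real.log 2 ≤ (0.7 : ℝ) := by linarith [Real.log_two_lt_d9]
  -- For `K = 1` the first entry of the maximum vanishes, and only `δ ≤ 1/2` keeps `M` away from
  -- zero.
  have hM3 : (0.69 : ℝ) ≤ M := by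
    rcases hKδ with h | h
    · have : Real.log 2 ≤ Real.log K := Real.log_le_log (by norm_num) (by exact_mod_cast h)
      linarith
    · have : Real.log 2 ≤ Real.log (1 / δ) :=
        Real.log_le_log (by norm_num) (by rw [le_div_iff₀ hδ]; linarith)
      linarith
  have hMpos : 0 < M := by linarith
  have hK1 : Real.log (K + 1) ≤ Real.log 2 + Real.log K := by
    rw [← Real.log_mul (by norm_num) (by positivity)]
    exact Real.log_le_log (by positivity) (by linarith)
  have hlogK1 : 0 < Real.log (K + 1) := Real.log_pos (by linarith)
  set t : ℝ := Real.log (K + 1) + Real.log (1 / δ) with ht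
  have htpos : 0 < t := by positivity
  -- `⌈t⌉ ≤ 1 + log 2 + log K + log (1/δ) ≤ 1.7 + 2M`, and `1.7 ≤ 3M`.
  have hPub : (⌈t⌉₊ : ℝ) ≤ 5 * M := by
    have := (Nat.ceil_lt_add_one htpos.le).le
    linarith
  have hPlb : t ≤ (⌈t⌉₊ : ℝ) := Nat.le_ceil t
  have hqs : 120 * B ^ 2 * (K * M) ≤ q * δK ^ 2 := by
    have : 120 * B ^ 2 * sampleSize K δK δ * δK ^ 2 ≤ q * δK ^ 2 :=
      mul_le_mul_of_nonneg_right hq (sq_nonneg _)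
    refine le_trans (le_of_eq ?_) this
    unfold sampleSize
    rw [← hM]
    field_simp
  refine ⟨⌈t⌉₊, (Nat.ceil_pos.2 htpos).ne', ?_, ?_, ?_⟩
  · have : 0 < q * δK ^ 2 := lt_of_lt_of_le (by positivity) hqs
    exact_mod_cast pos_of_mul_pos_left this (sq_nonneg _)
  · have h1 : Real.exp (-(⌈t⌉₊ : ℝ)) ≤ Real.exp (-t) := Real.exp_le_exp.2 (by linarith)
    have h2 : Real.exp (-t) = (K + 1 : ℝ)⁻¹ * δ := by
      rw [ht, neg_add, Real.exp_add, ← Real.log_inv, ← Real.log_inv, Real.exp_log (by positivity),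
        Real.exp_log (by positivity), one_div, inv_inv]
    calc _ ≤ (K + 1 : ℝ) * ((K + 1 : ℝ)⁻¹ * δ) := by rw [← h2]; gcongr
      _ = δ := by field_simp
  -- The constant is `120 = 12 · 5 · 2`, from the moment bound, `P ≤ 5M` and `K + 1 ≤ 2K`.
  · refine le_trans ?_ hqs
    calc 12 * (⌈t⌉₊ : ℝ) * (B ^ 2 * (K + 1)) ≤ 12 * (5 * M) * (B ^ 2 * (2 * K)) := by
          gcongr
          linarith
      _ = _ := by ring

end
-- From concentration to restricted isometry
section

open Matrix Finset

theorem norm_sq_rowSubsample_mulVec {ι : Type*} [Fintype ι] (Φ : Matrix ι ι ℂ)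
    {S : Finset ι} {q : ℕ} (Q : Fin q → ι) {x : ι → ℂ}
    (hx : Function.support x ⊆ (S : Set ι)) :
    (q : ℝ) * ‖WithLp.toLp 2 ((rowSubsample Φ Q).mulVec x)‖ ^ 2 =
      ∑ j, Complex.normSq ((fun b : S => ((Real.sqrt (Fintype.card ι) : ℝ) : ℂ) * Φ (Q j) b) ⬝ᵥ
        fun b => x b) := by
  rw [PiLp.norm_sq_eq_of_L2, mul_sum]
  refine sum_congr rfl fun j _ => ?_
  have hq : (q : ℝ) ≠ 0 := by
    have := j.pos
    positivity
  have h1 : ((fun b : S => ((Real.sqrt (Fintype.card ι) : ℝ) : ℂ) * Φ (Q j) b) ⬝ᵥ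
      fun b => x b) = ((Real.sqrt (Fintype.card ι) : ℝ) : ℂ) * (Φ *ᵥ x) (Q j) := by
    simp only [dotProduct, mulVec, mul_sum, mul_assoc]
    rw [sum_coe_sort S (fun b => ((Real.sqrt (Fintype.card ι) : ℝ) : ℂ) * (Φ (Q j) b * x b))]
    refine sum_subset (subset_univ S) fun b _ hb => ?_
    have : x b = 0 := by
      by_contra h
      exact hb (hx h)
    rw [this, mul_zero, mul_zero]
  have h2 : (rowSubsample Φ Q *ᵥ x) j =
      ((Real.sqrt ((Fintype.card ι : ℝ) / q) : ℝ) : ℂ) * (Φ *ᵥ x) (Q j) := by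
    unfold rowSubsample
    rw [smul_mulVec]
    rfl
  rw [h1]
  simp only [h2]
  rw [← Complex.normSq_eq_norm_sq, map_mul, map_mul, Complex.normSq_ofReal, Complex.normSq_ofReal,
    Real.mul_self_sqrt (by positivity), Real.mul_self_sqrt (by positivity)]
  field_simp

theorem norm_sq_toLp_of_support_subset {ι : Type*} [Fintype ι] {S : Finset ι} {x : ι → ℂ}
    (hx : Function.support x ⊆ (S : Set ι)) :
    ‖WithLp.toLp 2 x‖ ^ 2 = ∑ b : S, Complex.normSq (x b) := by
  rw [PiLp.norm_sq_eq_of_L2, sum_coe_sort S (fun b => Complex.normSq (x b))]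
  simp only [Complex.normSq_eq_norm_sq]
  symm
  refine sum_subset (subset_univ S) fun b _ hb => ?_
  have : x b = 0 := by
    by_contra h
    exact hb (hx h)
  simp [this]

/-- Rows of bounded entries which are isotropic on the columns in `S`, drawn independently and
uniformly, give a matrix with the restricted isometry property on `S`. -/
theorem one_sub_le_sampleProb_hasRIPOn {ι X : Type*} [Fintype ι] [Fintype X] [Nonempty X]
    (Φ : Matrix ι ι ℂ) (f : X → ι) {B : ℝ} (hB : 0 < B)
    {S : Finset ι} {K : ℕ} (hS : S.card = K + 1) (hK : 1 ≤ K)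
    (hΦ : ∀ x, ∀ b ∈ S, ‖Φ (f x) b‖ ≤ B / Real.sqrt (Fintype.card ι))
    (hdiag : ∀ b ∈ S, (Fintype.card ι : ℂ) * ∑ x, star (Φ (f x) b) * Φ (f x) b = Fintype.card X)
    (hoff : ∀ b ∈ S, ∀ c ∈ S, b ≠ c → ∑ x, star (Φ (f x) b) * Φ (f x) c = 0)
    {δK δ : ℝ} (hδK : 0 < δK) (hδK1 : δK ≤ Real.exp (-1)) (hδ : 0 < δ) (hδ1 : δ < 1)
    (hKδ : 2 ≤ K ∨ δ ≤ 1 / 2) {q : ℕ} (hq : 120 * B ^ 2 * sampleSize K δK δ ≤ q) :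
    1 - δ ≤ sampleProb X q fun Q => HasRIPOn (rowSubsample Φ fun j => f (Q j)) (K + 1) S δK := by
  classical
  obtain ⟨P, hP, hq0, hPδ, hqP⟩ :=
    exists_exponent_of_sampleSize_le hB hK hδK hδK1 hδ hδ1 hKδ hq
  have : Nonempty ι := Nonempty.map f inferInstance
  have hN : (0 : ℝ) < Fintype.card ι := by exact_mod_cast Fintype.card_pos
  have hcS : (Fintype.card S : ℝ) = K + 1 := by rw [Fintype.card_coe, hS]; push_cast; rfl
  set y : X → S → ℂ := fun x b => ((Real.sqrt (Fintype.card ι) : ℝ) : ℂ) * Φ (f x) b with hy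
  have hyL : ∀ x, ∑ b, Complex.normSq (y x b) ≤ B ^ 2 * (K + 1) := by
    intro x
    have : ∀ b ∈ (univ : Finset S), Complex.normSq (y x b) ≤ B ^ 2 := by
      intro b _
      rw [hy, map_mul, Complex.normSq_ofReal, Real.mul_self_sqrt hN.le, Complex.normSq_eq_norm_sq]
      have h := pow_le_pow_left₀ (norm_nonneg _) (hΦ x b b.2) 2
      rw [div_pow, Real.sq_sqrt hN.le, le_div_iff₀ hN] at h
      linarith
    refine (sum_le_card_nsmul _ _ _ this).trans_eq ?_
    rw [nsmul_eq_mul, card_univ, hcS, mul_comm]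
  have hiso : ∑ x, vecMulVec (star (y x)) (y x) = (Fintype.card X : ℂ) • 1 := by
    ext b c
    have hs : ∀ x, vecMulVec (star (y x)) (y x) b c =
        (Fintype.card ι : ℂ) * (star (Φ (f x) b) * Φ (f x) c) := by
      intro x
      have hsq : ((Real.sqrt (Fintype.card ι) : ℝ) : ℂ) * ((Real.sqrt (Fintype.card ι) : ℝ) : ℂ) =
          (Fintype.card ι : ℂ) := by
        rw [← Complex.ofReal_mul, Real.mul_self_sqrt hN.le, Complex.ofReal_natCast]
      rw [vecMulVec_apply, Pi.star_apply, hy]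
      simp only [star_mul', Complex.star_def, Complex.conj_ofReal]
      rw [← hsq]
      ring
    rw [Matrix.sum_apply, Matrix.smul_apply, one_apply]
    simp only [hs]
    rw [← mul_sum]
    by_cases hbc : b = c
    · subst hbc
      rw [hdiag b b.2]
      simp
    · rw [hoff b b.2 c c.2 fun h => hbc (Subtype.ext h)]
      simp [hbc]
  have hδK' : δK ≤ 1 := hδK1.trans (Real.exp_le_one_iff.2 (by norm_num))
  have hdev := card_deviation_le y (by positivity) hyL hiso hq0 hP hδK hδK' hqP
  have hq' : (0 : ℝ) < q := by exact_mod_cast hq0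
  refine (one_sub_le_sampleProb (δ := δ) (hdev.trans ?_)).trans (sampleProb_mono fun Q hQ => ?_)
  · rw [hcS, Nat.card_eq_fintype_card]
    gcongr
  · intro x hx _
    have h := hQ fun b => x b
    rw [hy, ← norm_sq_rowSubsample_mulVec Φ (fun j => f (Q j)) hx,
      ← norm_sq_toLp_of_support_subset hx, ← mul_sub, abs_mul, abs_of_pos hq', mul_assoc] at h
    have h' := abs_le.1 (le_of_mul_le_mul_left h hq')
    constructor <;> linarith [h'.1, h'.2]

/-! ### Characters, syndromes and the rank of the syndrome matrix -/

theorem ZMod.neg_one_pow_val_add (a b : ZMod 2) :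
    (-1 : ℂ) ^ (a + b).val = (-1) ^ a.val * (-1) ^ b.val := by
  rw [ZMod.val_add, ← pow_add]
  exact (neg_one_pow_eq_pow_mod_two _).symm

theorem ZMod.val_two_eq_zero_or_one (a : ZMod 2) : a.val = 0 ∨ a.val = 1 := by
  have := a.val_lt
  omega

theorem ZMod.neg_one_pow_val_eq (a : ZMod 2) :
    (-1 : ℂ) ^ a.val = 1 - 2 * ((a.val : ℝ) : ℂ) := by
  rcases a.val_two_eq_zero_or_one with h | h <;> norm_num [h]

theorem ZMod.neg_one_pow_val_mul_of_ne {a b : ZMod 2} (h : a ≠ b) :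
    (-1 : ℂ) ^ a.val * (-1) ^ b.val = -1 := by
  have h' : a.val ≠ b.val := fun e => h (ZMod.val_injective 2 e)
  rcases a.val_two_eq_zero_or_one with ha | ha <;>
    rcases b.val_two_eq_zero_or_one with hb | hb <;> simp_all

variable {A : Type*} [AddCommGroup A] [Module (ZMod 2) A]

/-- Orthogonality of characters of `M`: translation by `m₀` permutes `M` and flips the sign of every
term. -/
theorem sum_neg_one_pow_mul_eq_zero {β : LinearMap.BilinForm (ZMod 2) A}
    (M : Submodule (ZMod 2) A) [Fintype M] {b c : A} {m₀ : M} (h : β m₀ b ≠ β m₀ c) :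
    ∑ m : M, (-1 : ℂ) ^ (β m b).val * (-1) ^ (β m c).val = 0 := by
  have e : ∑ m : M, (-1 : ℂ) ^ (β m b).val * (-1) ^ (β m c).val =
      -∑ m : M, (-1 : ℂ) ^ (β m b).val * (-1) ^ (β m c).val := by
    conv_lhs => rw [← Equiv.sum_comp (Equiv.addRight m₀)]
    rw [← sum_neg_distrib]
    refine sum_congr rfl fun m _ => ?_
    simp only [Equiv.coe_addRight, Submodule.coe_add, map_add, LinearMap.add_apply,
      ZMod.neg_one_pow_val_add]
    linear_combination ((-1 : ℂ) ^ (β m b).val * (-1) ^ (β m c).val) *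
      ZMod.neg_one_pow_val_mul_of_ne h
  exact self_eq_neg.1 e

theorem HasDistinctNonzeroSyndromes.zero_notMem {β : LinearMap.BilinForm (ZMod 2) A}
    {M : Submodule (ZMod 2) A} {S : Finset A} (h : HasDistinctNonzeroSyndromes β M S) :
    (0 : A) ∉ S := fun h0 => h.1 0 h0 (by ext m; simp [syndrome])

theorem HasDistinctNonzeroSyndromes.exists_ne [DecidableEq A] {β : LinearMap.BilinForm (ZMod 2) A}
    (hβ : β.IsSymm)
    {M : Submodule (ZMod 2) A} {S : Finset A} (h : HasDistinctNonzeroSyndromes β M S)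
    {b c : A} (hb : b ∈ insert 0 S) (hc : c ∈ insert 0 S) (hbc : b ≠ c) :
    ∃ m₀ : M, β m₀ b ≠ β m₀ c := by
  have hz : syndrome β M 0 = 0 := by ext m; simp [syndrome]
  have hne : syndrome β M b ≠ syndrome β M c := by
    intro he
    rw [mem_insert] at hb hc
    rcases hb with rfl | hb <;> rcases hc with rfl | hc
    · exact hbc rfl
    · exact h.1 c hc (by rw [← he, hz])
    · exact h.1 b hb (by rw [he, hz])
    · exact hbc (h.2 hb hc he)
  obtain ⟨m, hm⟩ := Function.ne_iff.1 hne
  refine ⟨m, fun he => hm ?_⟩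
  simp only [syndrome]
  rw [← hβ.eq, ← hβ.eq m c]
  simpa using he

variable [Fintype A]

theorem norm_walshHadamard (β : LinearMap.BilinForm (ZMod 2) A) (a b : A) :
    ‖walshHadamard β a b‖ = 1 / Real.sqrt (Fintype.card A) := by
  simp [walshHadamard, abs_of_nonneg (Real.sqrt_nonneg _)]

theorem star_walshHadamard_mul (β : LinearMap.BilinForm (ZMod 2) A) (a b c : A) :
    star (walshHadamard β a b) * walshHadamard β a c =
      (Fintype.card A : ℂ)⁻¹ * ((-1) ^ (β a b).val * (-1) ^ (β a c).val) := by
  have hsq : ((Real.sqrt (Fintype.card A) : ℝ) : ℂ) * ((Real.sqrt (Fintype.card A) : ℝ) : ℂ) =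
      (Fintype.card A : ℂ) := by
    rw [← Complex.ofReal_mul, Real.mul_self_sqrt (by positivity), Complex.ofReal_natCast]
  simp only [walshHadamard, of_apply, star_div₀, star_pow, star_neg, star_one, Complex.star_def,
    Complex.conj_ofReal]
  rw [div_mul_div_comm, hsq, div_eq_inv_mul]

/-- Restricted isometry with a constant below one forces the columns of the syndrome matrix to be
linearly independent. -/
theorem rank_syndromeMatrix_of_hasRIPOn [DecidableEq A] (β : LinearMap.BilinForm (ZMod 2) A)
    {S : Finset A} (h0 : (0 : A) ∉ S) {q : ℕ} (Q : Fin q → A) {ε : ℝ} (hε : ε < 1)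
    (h : HasRIPOn (rowSubsample (walshHadamard β) Q) (S.card + 1) (insert 0 S) ε) :
    (syndromeMatrix β S Q).rank = S.card := by
  have hli : LinearIndependent ℝ (syndromeMatrix β S Q).col := by
    rw [← mulVec_injective_iff]
    refine (injective_iff_map_eq_zero (syndromeMatrix β S Q).mulVecLin).2 fun c hc => ?_
    have hc' : ∀ j, ∑ b : S, ((β (Q j) b).val : ℝ) * c b = 0 := fun j => congrFun hc j
    -- The entry at `0` cancels the constant part of `(-1)^β = 1 - 2β`: up to scaling, row `j` sends
    -- `x` to `∑ c - 2 ∑ β c - ∑ c`, which is zero because `c` lies in the kernel.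
    set x : A → ℂ := fun a => if ha : a ∈ S then ((c ⟨a, ha⟩ : ℝ) : ℂ)
      else if a = 0 then -((∑ b, c b : ℝ) : ℂ) else 0 with hx
    have hxS : ∀ b : S, x b = c b := fun b => by simp [hx]
    have hx0 : x 0 = -((∑ b, c b : ℝ) : ℂ) := by simp [hx, h0]
    have hsupp : Function.support x ⊆ ((insert 0 S : Finset A) : Set A) := by
      intro a ha
      by_contra hmem
      rw [mem_coe, mem_insert, not_or] at hmem
      exact ha (by simp [hx, hmem.1, hmem.2])
    have hcard : (Function.support x).ncard ≤ S.card + 1 := by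
      refine (Set.ncard_le_ncard hsupp (finite_toSet _)).trans ?_
      rw [Set.ncard_coe_finset, card_insert_of_notMem h0]
    have hWx : ∀ j, (walshHadamard β *ᵥ x) (Q j) = 0 := by
      intro j
      have e1 : (walshHadamard β *ᵥ x) (Q j) =
          ∑ a ∈ insert 0 S, walshHadamard β (Q j) a * x a := by
        refine (sum_subset (subset_univ _) fun b _ hb => ?_).symm
        have : x b = 0 := by
          by_contra h
          exact hb (hsupp h)
        rw [this, mul_zero]
      rw [e1, sum_insert h0, ← sum_coe_sort S, hx0]
      simp only [hxS, walshHadamard, of_apply, map_zero, ZMod.val_zero,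
        ZMod.neg_one_pow_val_eq]
      have hcj : ∑ b : S, (((β (Q j) b).val : ℝ) : ℂ) * (c b : ℂ) = 0 := by
        have := congrArg (fun t : ℝ => (t : ℂ)) (hc' j)
        push_cast at this ⊢
        exact this
      have e2 : ∀ b : S, (1 - 2 * (((β (Q j) b).val : ℝ) : ℂ)) /
          ((Real.sqrt (Fintype.card A) : ℝ) : ℂ) * (c b : ℂ) =
          1 / ((Real.sqrt (Fintype.card A) : ℝ) : ℂ) * (c b : ℂ) -
          2 / ((Real.sqrt (Fintype.card A) : ℝ) : ℂ) *
            ((((β (Q j) b).val : ℝ) : ℂ) * (c b : ℂ)) := fun b => by ring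
      simp only [e2]
      rw [sum_sub_distrib, ← mul_sum, ← mul_sum, hcj]
      push_cast
      ring
    have hHx : (rowSubsample (walshHadamard β) Q) *ᵥ x = 0 := by
      unfold rowSubsample
      rw [smul_mulVec]
      ext j
      have : ((walshHadamard β).submatrix Q id *ᵥ x) j = 0 := hWx j
      rw [Pi.smul_apply, this, smul_zero, Pi.zero_apply]
    have hrip := (h x hsupp hcard).1
    rw [hHx, WithLp.toLp_zero, norm_zero, zero_pow two_ne_zero] at hrip
    have hnx : ‖WithLp.toLp 2 x‖ = 0 := by
      have : ‖WithLp.toLp 2 x‖ ^ 2 ≤ 0 := by nlinarith [sq_nonneg ‖WithLp.toLp 2 x‖]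
      exact pow_eq_zero_iff two_ne_zero |>.1 (le_antisymm this (sq_nonneg _))
    have hx00 : x = 0 := by
      rw [norm_eq_zero] at hnx
      simpa using hnx
    ext b
    have := hxS b
    rw [hx00] at this
    simpa using this.symm
  rw [rank_eq_finrank_span_cols, finrank_span_eq_card hli, Fintype.card_coe]

end

/-! ### Assembly of the three statements -/

theorem theorem3 :
    -- the row-subsampled Walsh–Hadamard matrix and the restricted syndrome matrix
    (∃ C : ℝ, 0 < C ∧ ∃ δ₀ : ℝ, 0 < δ₀ ∧
      ∀ (A : Type*) [AddCommGroup A] [Module (ZMod 2) A] [Fintype A] [DecidableEq A]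
        (β : LinearMap.BilinForm (ZMod 2) A), β.IsSymm → β.Nondegenerate →
      ∀ (M : Submodule (ZMod 2) A) (KM : Finset A), HasDistinctNonzeroSyndromes β M KM →
      ∀ K : ℕ, KM.card = K → 1 ≤ K →
      ∀ δK : ℝ, 0 < δK → δK ≤ δ₀ →
      ∀ δ : ℝ, 0 < δ → δ < 1 → (2 ≤ K ∨ δ ≤ 1 / 2) →
      ∀ q : ℕ, C * sampleSize K δK δ ≤ (q : ℝ) →
        1 - δ ≤ sampleProb M q (fun Q =>
          HasRIPOn (rowSubsample (walshHadamard β) (fun j => (Q j : A))) (K + 1)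
              (insert 0 KM) δK ∧
            (syndromeMatrix β KM (fun j => (Q j : A))).rank = K ∧
            ((syndromeMatrix β KM (fun j => (Q j : A))).transpose *
              syndromeMatrix β KM (fun j => (Q j : A))).rank = K)) ∧
    -- restricted isometry with a constant below one forces full column rank
    (∀ (A : Type*) [AddCommGroup A] [Module (ZMod 2) A] [Fintype A] [DecidableEq A]
        (β : LinearMap.BilinForm (ZMod 2) A), β.IsSymm → β.Nondegenerate →
      ∀ (M : Submodule (ZMod 2) A) (KM : Finset A), HasDistinctNonzeroSyndromes β M KM →
      ∀ (q : ℕ) (Q : Fin q → M) (δK : ℝ), δK < 1 →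
        HasRIPOn (rowSubsample (walshHadamard β) (fun j => (Q j : A))) (KM.card + 1)
          (insert 0 KM) δK →
        (syndromeMatrix β KM (fun j => (Q j : A))).rank = KM.card) ∧
    -- the same sample size for every unitary matrix with entries of order `1 / √N`
    (∀ B : ℝ, 0 < B → ∃ C : ℝ, 0 < C ∧ ∃ δ₀ : ℝ, 0 < δ₀ ∧
      ∀ (ι : Type*) [Fintype ι] [DecidableEq ι] (Φ : Matrix ι ι ℂ),
        Φ ∈ Matrix.unitaryGroup ι ℂ →
        (∀ i j, ‖Φ i j‖ ≤ B / Real.sqrt (Fintype.card ι)) →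
      ∀ (S : Finset ι) (K : ℕ), S.card = K + 1 → 1 ≤ K →
      ∀ δK : ℝ, 0 < δK → δK ≤ δ₀ →
      ∀ δ : ℝ, 0 < δ → δ < 1 → (2 ≤ K ∨ δ ≤ 1 / 2) →
      ∀ q : ℕ, C * sampleSize K δK δ ≤ (q : ℝ) →
        1 - δ ≤ sampleProb ι q (fun Q => HasRIPOn (rowSubsample Φ Q) (K + 1) S δK)) := by
  -- Walsh–Hadamard entries have modulus exactly `1/√N`, hence `B = 1` in the first constant.
  refine ⟨⟨120 * 1 ^ 2, by norm_num, Real.exp (-1), Real.exp_pos _, ?_⟩, ?_, fun B hB =>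
    ⟨120 * B ^ 2, by positivity, Real.exp (-1), Real.exp_pos _, ?_⟩⟩
  · intro A _ _ _ _ β hβ _ M KM hKM K hcard hK δK hδK hδK1 δ hδ hδ1 hKδ q hq
    have := Fintype.ofFinite M
    have h0 := hKM.zero_notMem
    have hN : (Fintype.card A : ℂ) ≠ 0 := by
      have : Fintype.card A ≠ 0 := Fintype.card_ne_zero
      exact_mod_cast this
    refine (one_sub_le_sampleProb_hasRIPOn (walshHadamard β) (fun m : M => (m : A)) one_pos
      (S := insert 0 KM) (by rw [Finset.card_insert_of_notMem h0, hcard]) hK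
      (fun m b _ => (norm_walshHadamard β m b).le) (fun b _ => ?_) (fun b hb c hc hbc => ?_)
      hδK hδK1 hδ hδ1 hKδ hq).trans (sampleProb_mono fun Q hQ => ?_)
    · simp only [star_walshHadamard_mul, ← pow_add, ← two_mul, pow_mul, neg_one_sq, one_pow]
      simp only [Finset.sum_const, Finset.card_univ, nsmul_eq_mul, mul_one]
      field_simp
    · obtain ⟨m₀, hm₀⟩ := hKM.exists_ne hβ hb hc hbc
      simp only [star_walshHadamard_mul]
      rw [← Finset.mul_sum, sum_neg_one_pow_mul_eq_zero M hm₀, mul_zero]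
    · have hε : δK < 1 := hδK1.trans_lt (Real.exp_lt_one_iff.2 (by norm_num))
      have hr : (syndromeMatrix β KM (fun j => (Q j : A))).rank = K := by
        rw [rank_syndromeMatrix_of_hasRIPOn β h0 _ hε (by rwa [hcard]), hcard]
      exact ⟨hQ, hr, by rw [Matrix.rank_transpose_mul_self, hr]⟩
  · intro A _ _ _ _ β _ _ M KM hKM q Q δK hδK h
    exact rank_syndromeMatrix_of_hasRIPOn β hKM.zero_notMem _ hδK h
  · intro ι _ _ Φ hΦ hB' S K hS hK δK hδK hδK1 δ hδ hδ1 hKδ q hq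
    have hne : S.Nonempty := Finset.card_pos.1 (by omega)
    have : Nonempty ι := ⟨hne.choose⟩
    have horth : ∀ b c, ∑ x, star (Φ x b) * Φ x c = (1 : Matrix ι ι ℂ) b c := by
      intro b c
      rw [← Matrix.mem_unitaryGroup_iff'.1 hΦ, Matrix.mul_apply]
      rfl
    refine one_sub_le_sampleProb_hasRIPOn Φ id hB hS hK (fun i b _ => hB' i b) (fun b _ => ?_)
      (fun b _ c _ hbc => ?_) hδK hδK1 hδ hδ1 hKδ hq
    · simp only [id, horth, Matrix.one_apply_eq, mul_one]
    · simp only [id, horth, Matrix.one_apply_ne hbc]
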